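/- Let $(X,d)$ be an unbounded metric space and write $B_\varepsilon(x)=\{y\in X: d(x,y)\le\varepsilon\}$. Let $\phi:X\to\omega$ be a function that is bounded-to-bounded (a set $B\subset X$ is bounded if and only if $\phi(B)$ is bounded, i.e. finite) and boundedly oscillating (there is a real $D$ such that for every real $\varepsilon$ there is a bounded $B\subset X$ with $\mathrm{diam}\,\phi(B_\varepsilon(x))\le D$ for all $x\in X\setminus B$). Let $X^\sharp$ be the space of all ultrafilters on $X$ that contain the complements of all bounded subsets of $X$, a subspace of the Stone–Čech compactification $\beta X_d$ of $X$ with the discrete topology. Call $p,q\in X^\sharp$ parallel if for some $\varepsilon>0$ we have $B_\varepsilon(P)\in q$ for all $P\in p$ and $B_\varepsilon(Q)\in p$ for all $Q\in q$, where $B_\varepsilon(A)=\{x\in X: d(x,A)\le\varepsilon\}$. The corona $\check X$ is the quotient space of $X^\sharp$ by the smallest closed equivalence relation on $X^\sharp$ that contains all pairs of parallel ultrafilters, and $\check p\in\check X$ denotes the class of $p\in X^\sharp$. For a point $x$ of a topological space $Y$ let the character $\chi(x,Y)$ be the smallest cardinality of a neighborhood base at $x$. Let $\omega^*=\beta\omega\setminus\omega$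 be the space of nonprincipal ultrafilters on $\omega$, let $\mathfrak u=\min_{\mathcal U\in\omega^*}\chi(\mathcal U,\omega^*)$, and let $\mathfrak d$ be the cofinality of $\omega^\omega$ with the pointwise order. For $\mathcal U\in\omega^*$ let $\mathfrak q(\mathcal U)$ be the coinitiality of the set of finite-to-one functions $\omega\to\omega$ preordered by $f\le_{\mathcal U}g\iff\{n\in\omega:f(n)\le g(n)\}\in\mathcal U$, i.e. the smallest cardinality of a set $\mathcal F$ of such functions such that every such $g$ satisfies $f\le_{\mathcal U}g$ for some $f\in\mathcal F$. Then for every $p\in X^\sharp$, with $\phi(p)=\{A\subset\omega:\phi^{-1}(A)\in p\}\in\omega^*$: 1. $\chi(\check p,\check X)\le\max\{\chi(p,X^\sharp),\mathfrak d\}$; 2. $\chi(\check p,\check X)\ge\chi(\phi(p),\omega^*)\ge\mathfrak u$; 3. if $X$ has no asymptotically isolated balls (that is, there is no real $\varepsilon$ such that for every real $\delta\ge\varepsilon$ some $x\in X$ satisfies $B_\varepsilon(x)=B_\delta(x)$), then $\chi(\check p,\check X)\ge\max\{\chi(\phi(p),\omega^*),\mathfrak q(\phi(p))\}\ge\max\{\mathfrak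 u,\mathfrak d\}$. -/

import Mathlib

open Filter Topology Cardinal

universe u

namespace Higson

/-- The coinitiality of a relation `r` (a reflexive transitive one, read as `≤`): the smallest
cardinality of a set `S` such that every `x` has some `y ∈ S` with `y ≤ x`. -/
noncomputable def coin {α : Type u} (r : α → α → Prop) : Cardinal.{u} :=
  ⨅ S : {S : Set α // ∀ x, ∃ y ∈ S, r y x}, #S.1

/-- The character of a point `x` of a topological space: the coinitiality of the set of
neighborhoods of `x` ordered by inclusion, that is, the smallest cardinality of a neighborhood
base at `x`. -/
noncomputable def character {Y : Type u} [TopologicalSpace Y] (x : Y) : Cardinal.{u} :=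
  coin (fun U V : {N : Set Y // N ∈ 𝓝 x} => U.1 ⊆ V.1)

/-- `f` is bounded-to-bounded: a set is bounded if and only if its image is bounded. -/
def BoundedToBounded {X Y : Type*} [MetricSpace X] [MetricSpace Y] (f : X → Y) : Prop :=
  ∀ B : Set X, Bornology.IsBounded B ↔ Bornology.IsBounded (f '' B)

/-- `f` is boundedly oscillating: for some real `D` and every real `ε`, the images of all
`ε`-balls with centers outside a bounded set have diameter at most `D`. -/
def BoundedlyOscillating {X Y : Type*} [MetricSpace X] [MetricSpace Y] (f : X → Y) : Prop :=
  ∃ D : ℝ, ∀ ε : ℝ, ∃ B : Set X, Bornology.IsBounded B ∧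
    ∀ x ∉ B, ∀ y ∈ Metric.closedBall x ε, ∀ z ∈ Metric.closedBall x ε, dist (f y) (f z) ≤ D

/-- `X` has asymptotically isolated balls. -/
def HasAsymptoticallyIsolatedBalls (X : Type*) [MetricSpace X] : Prop :=
  ∃ ε : ℝ, ∀ δ : ℝ, ε ≤ δ → ∃ x : X, Metric.closedBall x ε = Metric.closedBall x δ

/-- The space `X^♯` of ultrafilters on `X` containing all complements of bounded sets, as a
subspace of the Stone–Čech compactification `Ultrafilter X` of the discrete set `X`. -/
abbrev Sharp (X : Type u) [MetricSpace X] : Type u :=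
  {p : Ultrafilter X // ∀ B : Set X, Bornology.IsBounded B → Bᶜ ∈ p}

/-- Parallel ultrafilters. Here `Metric.cthickening ε P` is the set of all `x` whose distance to
`P` is at most `ε`. -/
def Parallel {X : Type u} [MetricSpace X] (p q : Sharp X) : Prop :=
  ∃ ε : ℝ, 0 < ε ∧ (∀ P ∈ p.1, Metric.cthickening ε P ∈ q.1) ∧
    (∀ Q ∈ q.1, Metric.cthickening ε Q ∈ p.1)

/-- The smallest closed equivalence relation on `X^♯` that contains the parallel relation, as
the intersection of all such relations. -/
def coronaSetoid (X : Type u) [MetricSpace X] : Setoid (Sharp X) :=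
  sInf {s : Setoid (Sharp X) |
    IsClosed {z : Sharp X × Sharp X | s z.1 z.2} ∧ ∀ p q, Parallel p q → s p q}

/-- The corona of `X`, with the quotient topology. -/
abbrev Corona (X : Type u) [MetricSpace X] : Type u := Quotient (coronaSetoid X)

/-- The class of `p` in the corona. -/
def toCorona {X : Type u} [MetricSpace X] (p : Sharp X) : Corona X :=
  Quotient.mk (coronaSetoid X) p

/-- The remainder `ω^* = βω \ ω`: the space of nonprincipal ultrafilters on `ω`. -/
abbrev OmegaStar : Type := {U : Ultrafilter ℕ // ∀ n : ℕ, U ≠ pure n}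

theorem map_ne_pure {X : Type u} [MetricSpace X] {φ : X → ℕ} (hφ : BoundedToBounded φ)
    (p : Sharp X) (n : ℕ) : p.1.map φ ≠ pure n := by
  intro h
  have h1 : ({n} : Set ℕ) ∈ p.1.map φ := by
    rw [h]
    exact Filter.mem_pure.2 rfl
  have h2 : φ ⁻¹' {n} ∈ p.1 := Ultrafilter.mem_map.1 h1
  have h3 : Bornology.IsBounded (φ ⁻¹' {n}) :=
    (hφ _).2 (Bornology.isBounded_singleton.subset (Set.image_preimage_subset φ {n}))
  exact Ultrafilter.compl_mem_iff_notMem.1 (p.2 _ h3) h2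

/-- The image `φ(p)` of the ultrafilter `p` under a bounded-to-bounded `φ : X → ω`. -/
def image {X : Type u} [MetricSpace X] (φ : X → ℕ) (hφ : BoundedToBounded φ) (p : Sharp X) :
    OmegaStar :=
  ⟨p.1.map φ, map_ne_pure hφ p⟩

/-- The dominating number: the cofinality of `ω^ω` with the pointwise order. -/
noncomputable def dominatingNumber : Cardinal.{0} := Order.cof (ℕ → ℕ)

/-- The cardinal `𝔲`: the smallest character of a point of `ω^*`. -/
noncomputable def ultrafilterNumber : Cardinal.{0} := ⨅ U : OmegaStar, character U

/-- The cardinal `𝔮(U)`: the coinitiality of the set of bounded-to-bounded functions `ω → ω`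
preordered by `f ≤ g` iff `{n | f n ≤ g n} ∈ U`. -/
noncomputable def qNumber (U : OmegaStar) : Cardinal.{0} :=
  coin (fun f g : {f : ℕ → ℕ // BoundedToBounded f} => {n : ℕ | f.1 n ≤ g.1 n} ∈ U.1)

end Higson

namespace Higson

universe v

/-! ### Coinitiality and characters in spaces of ultrafilters -/

/-! Two ultrafilters have the same class in the corona iff they have no asymptotically separated
members (`coronaSetoid_eq`). Hence the character at the class of `p` is governed by asymptotic
neighborhoods of `p`: sets `A` with some `P ∈ p` separated from `Aᶜ`, compared modulo bounded sets
(`exists_base_corona`, `lift_character_corona_le`).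

Upper bound: thicken each member of a base of `p` at a rate controlled by a function from a
dominating family.

Bound by `φ(p)`: one residue class modulo `m > D` belongs to `φ(p)`. Its points are too far apart to
be confused by an error `D`, so images of asymptotic neighborhoods, cut down to this class, form a
base of `φ(p)`.

Bound by `𝔮`: the distance from `P` to `Aᶜ`, read along `φ`, is a finite-to-one function. Without
asymptotically isolated balls there are asymptotic neighborhoods with arbitrarily slowly growing
holes (`exists_porous_neighborhood`), so these functions are coinitial. A diagonal argument bounds
`𝔡` by the character and `𝔮` together (`dominatingNumber_le_max`). -/

theorem coin_le {α : Type u} {r : α → α → Prop} {S : Set α} (hS : ∀ x, ∃ y ∈ S, r y x) :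
    coin r ≤ #S :=
  ciInf_le' (fun S : {S : Set α // ∀ x, ∃ y ∈ S, r y x} => #S.1) ⟨S, hS⟩

theorem lift_coin_le {α : Type u} {r : α → α → Prop} {ι : Type v} {f : ι → α}
    (hf : ∀ x, ∃ i, r (f i) x) : lift.{v} (coin r) ≤ lift.{u} #ι := by
  refine le_trans (lift_le.2 (coin_le (S := Set.range f) fun x => ?_)) mk_range_le_lift
  obtain ⟨i, hi⟩ := hf x
  exact ⟨f i, ⟨i, rfl⟩, hi⟩

theorem exists_mk_eq_coin {α : Type u} {r : α → α → Prop} (hr : ∀ x, r x x) :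
    ∃ S : Set α, #S = coin r ∧ ∀ x, ∃ y ∈ S, r y x := by
  have : Nonempty {S : Set α // ∀ x, ∃ y ∈ S, r y x} :=
    ⟨⟨Set.univ, fun x => ⟨x, Set.mem_univ x, hr x⟩⟩⟩
  obtain ⟨S, hS⟩ := ciInf_mem (fun S : {S : Set α // ∀ x, ∃ y ∈ S, r y x} => #S.1)
  exact ⟨S.1, hS, S.2⟩

/-- A neighborhood assignment from which characters are estimated from above. -/
theorem lift_character_le {Y : Type u} [TopologicalSpace Y] {x : Y} {ι : Type v}
    {f : ι → Set Y} (hf : ∀ i, f i ∈ 𝓝 x) (h : ∀ N ∈ 𝓝 x, ∃ i, f i ⊆ N) :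
    lift.{v} (character x) ≤ lift.{u} #ι :=
  lift_coin_le (f := fun i => (⟨f i, hf i⟩ : {N : Set Y // N ∈ 𝓝 x})) fun N => h N.1 N.2

theorem exists_mk_eq_character {Y : Type u} [TopologicalSpace Y] (x : Y) :
    ∃ S : Set {N : Set Y // N ∈ 𝓝 x}, #S = character x ∧ ∀ N ∈ 𝓝 x, ∃ M ∈ S, M.1 ⊆ N := by
  obtain ⟨S, h1, h2⟩ := exists_mk_eq_coin
    (r := fun U V : {N : Set Y // N ∈ 𝓝 x} => U.1 ⊆ V.1) fun _ => subset_rfl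
  exact ⟨S, h1, fun N hN => h2 ⟨N, hN⟩⟩

/-- The predicate `C` is arbitrary so that the same lemmas serve both `X^♯` and `ω^*`. -/
theorem mem_nhds_ultrafilter_subtype {Y : Type u} {C : Ultrafilter Y → Prop} {p : Subtype C}
    {N : Set (Subtype C)} : N ∈ 𝓝 p ↔ ∃ A ∈ p.1, {q : Subtype C | A ∈ q.1} ⊆ N := by
  rw [nhds_subtype_eq_comap,
    ((ultrafilterBasis_is_basis.nhds_hasBasis (a := p.1)).comap Subtype.val).mem_iff]
  constructor
  · rintro ⟨_, ⟨⟨A, rfl⟩, hA⟩, h⟩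
    exact ⟨A, hA, h⟩
  · rintro ⟨A, hA, h⟩
    exact ⟨_, ⟨⟨A, rfl⟩, hA⟩, h⟩

theorem exists_base_ultrafilter {Y : Type u} {C : Ultrafilter Y → Prop} (p : Subtype C) :
    ∃ S : Set (Set Y), #S ≤ character p ∧ (∀ A ∈ S, A ∈ p.1) ∧
      ∀ B ∈ p.1, ∃ A ∈ S, ∀ q : Subtype C, A ∈ q.1 → B ∈ q.1 := by
  obtain ⟨S, h1, h2⟩ := exists_mk_eq_character p
  choose f hf hf' using fun N : {N : Set (Subtype C) // N ∈ 𝓝 p} =>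
    mem_nhds_ultrafilter_subtype.1 N.2
  refine ⟨f '' S, h1 ▸ mk_image_le, ?_, fun B hB => ?_⟩
  · rintro _ ⟨N, -, rfl⟩
    exact hf N
  · obtain ⟨M, hM, hMB⟩ := h2 {q | B ∈ q.1} (mem_nhds_ultrafilter_subtype.2 ⟨B, hB, subset_rfl⟩)
    exact ⟨f M, ⟨M, hM, rfl⟩, fun q hq => hMB (hf' M hq)⟩

theorem lift_character_ultrafilter_le {Y : Type u} {C : Ultrafilter Y → Prop} (p : Subtype C)
    {ι : Type v} {A : ι → Set Y} (hA : ∀ i, A i ∈ p.1)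
    (h : ∀ B ∈ p.1, ∃ i, ∀ q : Subtype C, A i ∈ q.1 → B ∈ q.1) :
    lift.{v} (character p) ≤ lift.{u} #ι := by
  refine lift_character_le (f := fun i => {q : Subtype C | A i ∈ q.1})
    (fun i => mem_nhds_ultrafilter_subtype.2 ⟨A i, hA i, subset_rfl⟩) fun N hN => ?_
  obtain ⟨B, hB, hBN⟩ := mem_nhds_ultrafilter_subtype.1 hN
  obtain ⟨i, hi⟩ := h B hB
  exact ⟨i, fun q hq => hBN (hi q hq)⟩

theorem finite_of_isBounded_nat {s : Set ℕ} (hs : Bornology.IsBounded s) : s.Finite :=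
  (Metric.isCompact_of_isClosed_isBounded (isClosed_discrete s) hs).finite_of_discrete

theorem OmegaStar.compl_mem {U : OmegaStar} {s : Set ℕ} (hs : s.Finite) : sᶜ ∈ U.1 := by
  rw [Ultrafilter.compl_mem_iff_notMem]
  intro h
  obtain ⟨n, -, hn⟩ := Ultrafilter.eq_pure_of_finite_mem hs h
  exact U.2 n hn

theorem OmegaStar.mem_of_diff_finite {U : OmegaStar} {A B : Set ℕ} (h : (A \ B).Finite)
    (hA : A ∈ U.1) : B ∈ U.1 :=
  Filter.mem_of_superset (Filter.inter_mem hA (OmegaStar.compl_mem h)) fun n hn => by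
    by_contra hB
    exact hn.2 ⟨hn.1, hB⟩

theorem finite_diff_of_omegaStar {A B : Set ℕ}
    (h : ∀ U : OmegaStar, A ∈ U.1 → B ∈ U.1) : (A \ B).Finite := by
  by_contra hinf
  have : NeBot (cofinite ⊓ 𝓟 (A \ B)) := by
    rw [inf_principal_neBot_iff]
    intro V hV
    by_contra hne
    refine hinf ((mem_cofinite.1 hV).subset fun n hn hnV => hne ⟨n, hnV, hn⟩)
  set U := Ultrafilter.of (cofinite ⊓ 𝓟 (A \ B))
  have hU : (U : Filter ℕ) ≤ cofinite ⊓ 𝓟 (A \ B) := Ultrafilter.of_le _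
  have hAB : A \ B ∈ U := hU (mem_inf_of_right (mem_principal_self _))
  have hne : ∀ n : ℕ, U ≠ pure n := by
    intro n hn
    have h1 : ({n}ᶜ : Set ℕ) ∈ U :=
      hU (mem_inf_of_left (mem_cofinite.2 (by simp)))
    rw [hn] at h1
    exact (Ultrafilter.mem_pure.1 h1) rfl
  have hB := h ⟨U, hne⟩ (Filter.mem_of_superset hAB Set.sdiff_subset)
  have hB' : Bᶜ ∈ U := Filter.mem_of_superset hAB fun n hn => hn.2
  exact Ultrafilter.compl_mem_iff_notMem.1 hB' hB

/-! ### Asymptotically separated sets -/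

variable {X : Type u} [MetricSpace X]

/-- Two sets are asymptotically separated if their `ε`-neighborhoods have bounded intersection
for every `ε`. -/
def Separated (P Q : Set X) : Prop :=
  ∀ ε : ℝ, Bornology.IsBounded {x | x ∈ P ∧ ∃ y ∈ Q, dist x y ≤ ε}

theorem separated_iff (o : X) {P Q : Set X} :
    Separated P Q ↔ ∀ ε : ℝ, ∃ R : ℝ, ∀ x ∈ P, ∀ y ∈ Q, dist x y ≤ ε → dist x o ≤ R := by
  refine forall_congr' fun ε => ?_
  rw [Metric.isBounded_iff_subset_closedBall o]
  refine exists_congr fun R => ⟨fun h x hx y hy hxy => h ⟨hx, y, hy, hxy⟩, ?_⟩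
  rintro h x ⟨hx, y, hy, hxy⟩
  exact h x hx y hy hxy

theorem Separated.symm {P Q : Set X} (h : Separated P Q) : Separated Q P := by
  rcases isEmpty_or_nonempty X with hX | ⟨⟨o⟩⟩
  · intro ε
    rw [Set.eq_empty_of_isEmpty {x | x ∈ Q ∧ ∃ y ∈ P, dist x y ≤ ε}]
    exact Bornology.isBounded_empty
  rw [separated_iff o] at h ⊢
  intro ε
  obtain ⟨R, hR⟩ := h ε
  refine ⟨ε + R, fun x hx y hy hxy => ?_⟩
  have h1 := hR y hy x hx (by rwa [dist_comm])
  linarith [dist_triangle x y o]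

theorem Separated.mono {P Q P' Q' : Set X} (h : Separated P Q) (hP : P' ⊆ P) (hQ : Q' ⊆ Q) :
    Separated P' Q' := fun ε => (h ε).subset fun _ ⟨hx, y, hy, hxy⟩ => ⟨hP hx, y, hQ hy, hxy⟩

theorem Separated.isBounded_inter {P Q : Set X} (h : Separated P Q) :
    Bornology.IsBounded (P ∩ Q) :=
  (h 0).subset fun x hx => ⟨hx.1, x, hx.2, (dist_self x).le⟩

/-- Asymptotic normality of metric spaces. -/
theorem Separated.exists_between {P Q : Set X} (h : Separated P Q) :
    ∃ S : Set X, Separated P Sᶜ ∧ Separated S Q := by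
  rcases isEmpty_or_nonempty X with hX | ⟨⟨o⟩⟩
  · exact ⟨∅, h.mono subset_rfl fun x => (hX.false x).elim, h.mono (Set.empty_subset _) subset_rfl⟩
  -- These are the points about as close to `P` as to `Q` or closer. A point of `P` near the
  -- complement is near `Q`; a point of `Q` near this set is near `P`.
  refine ⟨{y | ∃ x ∈ P, ∀ z ∈ Q, dist y x ≤ dist y z + 1}, ?_, ?_⟩
  · rw [separated_iff o] at h ⊢
    intro ε
    obtain ⟨R, hR⟩ := h (2 * ε)
    refine ⟨R, fun x hx y hy hxy => ?_⟩
    simp only [Set.mem_compl_iff, Set.mem_ofPred_eq, not_exists, not_and, not_forall, not_le] at hy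
    obtain ⟨z, hz, hyz⟩ := hy x hx
    refine hR x hx z hz ?_
    linarith [dist_triangle x y z, dist_comm x y]
  · have h' := h.symm
    rw [separated_iff o] at h'
    refine Separated.symm ((separated_iff o).2 fun ε => ?_)
    obtain ⟨R, hR⟩ := h' (2 * ε + 1)
    refine ⟨R, fun z hz y hy hzy => ?_⟩
    obtain ⟨x, hx, hxy⟩ := hy
    refine hR z hz x hx ?_
    linarith [dist_triangle z y x, hxy z hz, dist_comm y z]

/-! ### Proximality of ultrafilters and the corona relation -/

theorem Sharp.not_isBounded {p : Sharp X} {P : Set X} (hP : P ∈ p.1) :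
    ¬ Bornology.IsBounded P := fun h => Ultrafilter.compl_mem_iff_notMem.1 (p.2 P h) hP

theorem exists_sharp_mem {T : Set X} (hT : ¬ Bornology.IsBounded T) :
    ∃ p : Sharp X, T ∈ p.1 := by
  have : NeBot (Bornology.cobounded X ⊓ 𝓟 T) := by
    rw [inf_principal_neBot_iff]
    intro V hV
    by_contra hne
    refine hT (Bornology.IsBounded.subset (t := Vᶜ) ?_ fun n hn hnV => hne ⟨n, hnV, hn⟩)
    rwa [Bornology.isBounded_def, compl_compl]
  have hU := Ultrafilter.of_le (Bornology.cobounded X ⊓ 𝓟 T)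
  exact ⟨⟨Ultrafilter.of _, fun B hB => hU (mem_inf_of_left hB)⟩,
    hU (mem_inf_of_right (mem_principal_self _))⟩

theorem isBounded_diff_of_sharp {A B : Set X} (h : ∀ q : Sharp X, A ∈ q.1 → B ∈ q.1) :
    Bornology.IsBounded (A \ B) := by
  by_contra hAB
  obtain ⟨q, hq⟩ := exists_sharp_mem hAB
  exact Ultrafilter.compl_mem_iff_notMem.1
    (Filter.mem_of_superset hq fun x hx => hx.2) (h q (Filter.mem_of_superset hq Set.sdiff_subset))

theorem mem_of_separated_compl {p : Sharp X} {P A : Set X} (hP : P ∈ p.1)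
    (h : Separated P Aᶜ) : A ∈ p.1 :=
  Ultrafilter.compl_notMem_iff.1 fun hA =>
    Sharp.not_isBounded (Filter.inter_mem hP hA) h.isBounded_inter

/-- The equivalence relation on `X^♯` of ultrafilters without asymptotically separated members. -/
def proximalSetoid (X : Type u) [MetricSpace X] : Setoid (Sharp X) where
  r p q := ∀ P ∈ p.1, ∀ Q ∈ q.1, ¬ Separated P Q
  iseqv := by
    refine ⟨fun p P hP Q hQ h => Sharp.not_isBounded (Filter.inter_mem hP hQ) h.isBounded_inter,
      fun h P hP Q hQ hPQ => h Q hQ P hP hPQ.symm, fun {p q r} h h' P hP Q hQ hPQ => ?_⟩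
    -- Transitivity is asymptotic normality: the middle ultrafilter must choose between `S` and
    -- `Sᶜ`.
    obtain ⟨S, h1, h2⟩ := hPQ.exists_between
    rcases Ultrafilter.mem_or_compl_mem q.1 S with hS | hS
    · exact h' S hS Q hQ h2
    · exact h P hP Sᶜ hS h1

theorem isClosed_proximalSetoid :
    IsClosed {z : Sharp X × Sharp X | proximalSetoid X z.1 z.2} := by
  rw [← isOpen_compl_iff, isOpen_iff_mem_nhds]
  rintro ⟨p, q⟩ h
  have h1 : ¬ ∀ P ∈ p.1, ∀ Q ∈ q.1, ¬ Separated P Q := h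
  push Not at h1
  obtain ⟨P, hP, Q, hQ, hPQ⟩ := h1
  refine Filter.mem_of_superset (prod_mem_nhds
    (mem_nhds_ultrafilter_subtype.2 ⟨P, hP, subset_rfl⟩)
    (mem_nhds_ultrafilter_subtype.2 ⟨Q, hQ, subset_rfl⟩)) ?_
  rintro ⟨p', q'⟩ ⟨hp', hq'⟩ h2
  exact h2 P hp' Q hq' hPQ

theorem Parallel.proximal {p q : Sharp X} (h : Parallel p q) : proximalSetoid X p q := by
  obtain ⟨ε, hε, h1, -⟩ := h
  intro P hP Q hQ hPQ
  refine Sharp.not_isBounded (Filter.inter_mem hQ (h1 P hP))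
    ((hPQ.symm (ε + 1)).subset fun x hx => ⟨hx.1, ?_⟩)
  obtain ⟨y, hy, hxy⟩ := Metric.mem_thickening_iff.1
    (Metric.cthickening_subset_thickening' (by linarith) (lt_add_one ε) P hx.2)
  exact ⟨y, hy, hxy.le⟩

/-- Unboundedly many points of `P` can be moved into `Q` by at most a fixed `ε`; an ultrafilter on
these points is parallel to its image under the move. -/
theorem exists_parallel {P Q : Set X} (h : ¬ Separated P Q) :
    ∃ p q : Sharp X, P ∈ p.1 ∧ Q ∈ q.1 ∧ Parallel p q := by
  have h' : ¬ ∀ ε : ℝ, Bornology.IsBounded {x | x ∈ P ∧ ∃ y ∈ Q, dist x y ≤ ε} := h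
  push Not at h'
  obtain ⟨ε, hε⟩ := h'
  set T := {x | x ∈ P ∧ ∃ y ∈ Q, dist x y ≤ ε}
  have hf : ∀ x, ∃ y, x ∈ T → y ∈ Q ∧ dist x y ≤ ε := by
    intro x
    by_cases hx : x ∈ T
    · obtain ⟨y, hy⟩ := hx.2
      exact ⟨y, fun _ => hy⟩
    · exact ⟨x, fun h => absurd h hx⟩
  choose f hf using hf
  obtain ⟨p, hp⟩ := exists_sharp_mem hε
  have hq : ∀ B : Set X, Bornology.IsBounded B → Bᶜ ∈ p.1.map f := by
    intro B hB
    refine Ultrafilter.mem_map.2 (Filter.mem_of_superset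
      (Filter.inter_mem hp (p.2 _ (hB.cthickening (δ := ε)))) fun x hx hxB => hx.2 ?_)
    exact Metric.mem_cthickening_of_dist_le x (f x) ε B hxB (hf x hx.1).2
  refine ⟨p, ⟨p.1.map f, hq⟩, Filter.mem_of_superset hp fun x hx => hx.1,
    Ultrafilter.mem_map.2 (Filter.mem_of_superset hp fun x hx => (hf x hx).1), max ε 1, by simp, fun A hA => ?_,
    fun A hA => ?_⟩
  · refine Ultrafilter.mem_map.2 (Filter.mem_of_superset (Filter.inter_mem hA hp) fun x hx => ?_)
    exact Metric.mem_cthickening_of_dist_le (f x) x _ A hx.1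
      (by rw [dist_comm]; exact (hf x hx.2).2.trans (le_max_left _ _))
  · refine Filter.mem_of_superset (Filter.inter_mem (Ultrafilter.mem_map.1 hA) hp) fun x hx => ?_
    exact Metric.mem_cthickening_of_dist_le x (f x) _ A hx.1
      ((hf x hx.2).2.trans (le_max_left _ _))

/-- Proximality is closed and contains parallelism. Conversely, each basic neighborhood of a
proximal pair contains a parallel pair, so every closed relation containing parallelism contains
proximality. -/
theorem coronaSetoid_eq : coronaSetoid X = proximalSetoid X := by
  refine le_antisymm (sInf_le ⟨isClosed_proximalSetoid, fun p q h => h.proximal⟩)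
    (le_sInf ?_)
  rintro s ⟨hs, hpar⟩ p q h
  suffices h : (p, q) ∈ closure {z : Sharp X × Sharp X | s z.1 z.2} from hs.closure_subset h
  refine mem_closure_iff_nhds.2 fun N hN => ?_
  rw [nhds_prod_eq, mem_prod_iff] at hN
  obtain ⟨U, hU, V, hV, hUV⟩ := hN
  obtain ⟨P, hP, hPU⟩ := mem_nhds_ultrafilter_subtype.1 hU
  obtain ⟨Q, hQ, hQV⟩ := mem_nhds_ultrafilter_subtype.1 hV
  obtain ⟨p', q', hp', hq', hpq⟩ := exists_parallel (h P hP Q hQ)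
  exact ⟨(p', q'), hUV ⟨hPU hp', hQV hq'⟩, hpar p' q' hpq⟩

theorem toCorona_eq_iff {p q : Sharp X} :
    toCorona p = toCorona q ↔ ∀ P ∈ p.1, ∀ Q ∈ q.1, ¬ Separated P Q := by
  have h : toCorona p = toCorona q ↔ coronaSetoid X p q := Quotient.eq
  rw [h, coronaSetoid_eq]
  rfl

/-! ### Neighborhoods in the corona -/

instance compactSpace_sharp : CompactSpace (Sharp X) := by
  refine isCompact_iff_compactSpace.1 (IsClosed.isCompact ?_)
  have h : {p : Ultrafilter X | ∀ B : Set X, Bornology.IsBounded B → Bᶜ ∈ p} =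
      ⋂ (B : Set X) (_ : Bornology.IsBounded B), {p : Ultrafilter X | Bᶜ ∈ p} := by
    ext p
    simp
  change IsClosed {p : Ultrafilter X | ∀ B : Set X, Bornology.IsBounded B → Bᶜ ∈ p}
  rw [h]
  exact isClosed_biInter fun B _ => ultrafilter_isClosed_basic _

/-- The neighborhoods of a point of the corona come from asymptotic neighborhoods of members of
the ultrafilter. -/
theorem exists_separated_of_mem_nhds {p : Sharp X} {N : Set (Corona X)}
    (hN : N ∈ 𝓝 (toCorona p)) :
    ∃ A : Set X, (∃ P ∈ p.1, Separated P Aᶜ) ∧ ∀ q : Sharp X, A ∈ q.1 → toCorona q ∈ N := by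
  obtain ⟨O, hON, hO, hpO⟩ := mem_nhds_iff.1 hN
  have hcont : Continuous (toCorona : Sharp X → Corona X) := continuous_quotient_mk'
  have hC : IsCompact (toCorona ⁻¹' O : Set (Sharp X))ᶜ :=
    (hO.preimage hcont).isClosed_compl.isCompact
  have hsep : ∀ q : Sharp X, ∃ Q : Set X, q ∈ (toCorona ⁻¹' O : Set (Sharp X))ᶜ →
      Q ∈ q.1 ∧ ∃ P ∈ p.1, Separated P Q := by
    intro q
    by_cases hq : q ∈ (toCorona ⁻¹' O : Set (Sharp X))ᶜ
    · have hne : ¬ toCorona p = toCorona q := fun h => hq (by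
        change toCorona q ∈ O
        rwa [← h])
      rw [toCorona_eq_iff] at hne
      push Not at hne
      obtain ⟨P, hP, Q, hQ, hPQ⟩ := hne
      exact ⟨Q, fun _ => ⟨hQ, P, hP, hPQ⟩⟩
    · exact ⟨∅, fun h => absurd h hq⟩
  choose Q hQ using hsep
  choose! hQ P hP hPQ using hQ
  -- By compactness, finitely many `Q q` catch all ultrafilters outside the neighborhood; the
  -- complement of their union is the required `A`.
  obtain ⟨t, ht, hcov⟩ := hC.elim_nhds_subcover (fun q => {r | Q q ∈ r.1}) fun q hq =>
    mem_nhds_ultrafilter_subtype.2 ⟨Q q, hQ q hq, subset_rfl⟩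
  refine ⟨(⋃ q ∈ t, Q q)ᶜ, ⟨⋂ q ∈ t, P q, ?_, ?_⟩, fun q hq => ?_⟩
  · exact (Filter.biInter_finset_mem t).2 fun q hq => hP q (ht q hq)
  · rw [compl_compl]
    intro ε
    refine ((Bornology.isBounded_biUnion_finset t).2 fun q hq => hPQ q (ht q hq) ε).subset ?_
    rintro x ⟨hx, y, hy, hxy⟩
    simp only [Set.mem_iUnion, Set.mem_iInter] at hx hy ⊢
    obtain ⟨q, hq, hyq⟩ := hy
    exact ⟨q, hq, hx q hq, y, hyq, hxy⟩
  · by_contra hqN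
    have hqO : q ∈ (toCorona ⁻¹' O : Set (Sharp X))ᶜ := fun h => hqN (hON h)
    have h1 := hcov hqO
    simp only [Set.mem_iUnion] at h1
    obtain ⟨r, hr, hqr⟩ := h1
    exact Ultrafilter.compl_mem_iff_notMem.1 hq
      (Filter.mem_of_superset hqr (Set.subset_biUnion_of_mem (u := Q) hr))

theorem setOf_separated_mem_nhds {p : Sharp X} {A : Set X} (h : ∃ P ∈ p.1, Separated P Aᶜ) :
    {z : Corona X | ∀ q : Sharp X, toCorona q = z → A ∈ q.1} ∈ 𝓝 (toCorona p) := by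
  refine mem_nhds_iff.2 ⟨{z | ∀ q : Sharp X, toCorona q = z → ∃ P ∈ q.1, Separated P Aᶜ},
    fun z hz q hq => ?_, ?_, ?_⟩
  · obtain ⟨P, hP, hPA⟩ := hz q hq
    exact mem_of_separated_compl hP hPA
  all_goals
    -- Having a member separated from `Aᶜ` depends only on the class, by normality. Thus the open
    -- condition on ultrafilters descends to the quotient.
    have hsat : ∀ q r : Sharp X, toCorona q = toCorona r → (∃ P ∈ q.1, Separated P Aᶜ) →
        ∃ P ∈ r.1, Separated P Aᶜ := by
      rintro q r hqr ⟨P, hP, hPA⟩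
      obtain ⟨S, h1, h2⟩ := hPA.exists_between
      refine ⟨S, Ultrafilter.compl_notMem_iff.1 fun hS => ?_, h2⟩
      exact toCorona_eq_iff.1 hqr P hP _ hS h1
  · refine (isQuotientMap_quotient_mk' (s := coronaSetoid X)).isOpen_preimage.1 ?_
    rw [isOpen_iff_mem_nhds]
    intro q hq
    obtain ⟨P, hP, hPA⟩ := hq q rfl
    exact mem_nhds_ultrafilter_subtype.2 ⟨P, hP, fun r hr s hs => hsat r s hs.symm ⟨P, hr, hPA⟩⟩
  · exact fun q hq => hsat p q hq.symm h

theorem exists_base_corona (p : Sharp X) :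
    ∃ S : Set (Set X), #S ≤ character (toCorona p) ∧
      (∀ A ∈ S, ∃ P ∈ p.1, Separated P Aᶜ) ∧
      ∀ B, (∃ P ∈ p.1, Separated P Bᶜ) → ∃ A ∈ S, Bornology.IsBounded (A \ B) := by
  obtain ⟨S, h1, h2⟩ := exists_mk_eq_character (toCorona p)
  choose f hf hf' using fun N : {N : Set (Corona X) // N ∈ 𝓝 (toCorona p)} =>
    exists_separated_of_mem_nhds N.2
  refine ⟨f '' S, h1 ▸ mk_image_le, ?_, fun B hB => ?_⟩
  · rintro _ ⟨N, -, rfl⟩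
    exact hf N
  · obtain ⟨M, hM, hMB⟩ := h2 _ (setOf_separated_mem_nhds hB)
    exact ⟨f M, ⟨M, hM, rfl⟩, isBounded_diff_of_sharp fun q hq => hMB (hf' M q hq) q rfl⟩

theorem lift_character_corona_le (p : Sharp X) {ι : Type v} {A : ι → Set X}
    (hA : ∀ i, ∃ P ∈ p.1, Separated P (A i)ᶜ)
    (h : ∀ B, (∃ P ∈ p.1, Separated P Bᶜ) → ∃ i, A i ⊆ B) :
    lift.{v} (character (toCorona p)) ≤ lift.{u} #ι := by
  refine lift_character_le (f := fun i => {z : Corona X | ∀ q : Sharp X, toCorona q = z → A i ∈ q.1})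
    (fun i => setOf_separated_mem_nhds (hA i)) fun N hN => ?_
  obtain ⟨B, hB, hBN⟩ := exists_separated_of_mem_nhds hN
  obtain ⟨i, hi⟩ := h B hB
  refine ⟨i, fun z => ?_⟩
  induction z using Quotient.inductionOn with
  | h q => exact fun hz => hBN q (Filter.mem_of_superset (hz q rfl) hi)

/-! ### The dominating number -/

theorem aleph0_lt_dominatingNumber : ℵ₀ < dominatingNumber := by
  obtain ⟨S, hS, hS'⟩ := Order.exists_cof_eq (α := ℕ → ℕ)
  have h : ¬ #S ≤ ℵ₀ := by
    intro hle
    have hc : S.Countable := le_aleph0_iff_set_countable.1 hle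
    have hne : S.Nonempty := hS.nonempty
    obtain ⟨s, rfl⟩ := hc.exists_eq_range hne
    obtain ⟨_, ⟨i, rfl⟩, hi⟩ := hS fun n => s n n + 1
    have := hi i
    simp at this
  rw [dominatingNumber, ← hS']
  exact not_le.1 h

theorem dominatingNumber_le {ι : Type} {h : ι → ℕ → ℕ}
    (hh : ∀ g : ℕ → ℕ, ∃ i, ∀ᶠ k in atTop, g k ≤ h i k) :
    dominatingNumber ≤ max #ι ℵ₀ := by
  have h1 : dominatingNumber ≤ #(Set.range fun z : ι × ℕ => fun k => max (h z.1 k) z.2) := by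
    refine Order.cof_le fun g => ?_
    obtain ⟨i, hi⟩ := hh g
    obtain ⟨K, hK⟩ := eventually_atTop.1 hi
    -- The constant absorbs the finitely many exceptions below `K`.
    refine ⟨_, ⟨(i, (Finset.range K).sup g), rfl⟩, fun k => ?_⟩
    rcases le_or_gt K k with hk | hk
    · exact (hK k hk).trans (le_max_left _ _)
    · exact (Finset.le_sup (Finset.mem_range.2 hk)).trans (le_max_right _ _)
  calc dominatingNumber ≤ #(ι × ℕ) := h1.trans mk_range_le
    _ = #ι * ℵ₀ := by simp
    _ ≤ max (max #ι ℵ₀) ℵ₀ := mul_le_max _ _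
    _ = max #ι ℵ₀ := by simp

/-! ### Bounded-to-bounded functions -/

theorem isBounded_nat_iff {s : Set ℕ} : Bornology.IsBounded s ↔ s.Finite :=
  ⟨finite_of_isBounded_nat, Set.Finite.isBounded⟩

theorem boundedToBounded_iff_tendsto {f : ℕ → ℕ} :
    BoundedToBounded f ↔ Tendsto f atTop atTop := by
  constructor
  · intro hf
    rw [← Nat.cofinite_eq_atTop]
    refine Tendsto.cofinite_of_finite_preimage_singleton fun n => ?_
    exact isBounded_nat_iff.1 ((hf _).2
      (Bornology.isBounded_singleton.subset (Set.image_preimage_subset f {n})))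
  · intro hf B
    rw [isBounded_nat_iff, isBounded_nat_iff]
    refine ⟨fun h => h.image f, fun h => ?_⟩
    rw [← Nat.cofinite_eq_atTop] at hf
    refine Set.Finite.subset ?_ (Set.subset_preimage_image f B)
    have := hf (mem_cofinite.2 (by rwa [compl_compl]) : (f '' B)ᶜ ∈ cofinite)
    simpa [mem_cofinite] using this

theorem isBounded_preimage_Iic {φ : X → ℕ} (hφ : BoundedToBounded φ)
    (n : ℕ) : Bornology.IsBounded {x | φ x ≤ n} :=
  (hφ _).2 (((Set.finite_Iic n).isBounded).subset (by rintro _ ⟨x, hx, rfl⟩; exact hx))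

/-- Each base set `A` and each `f` from a coinitial family give a function sending `k` to some `n ∈
A` with `n ≥ k` and `f n > k`. If `f` lies below a slow inverse of `g` on `A` up to finitely many
points, then `f n > k` forces `n > g k`. -/
theorem dominatingNumber_le_max (U : OmegaStar) :
    dominatingNumber ≤ max (character U) (qNumber U) := by
  obtain ⟨S, hS, hSU, hSb⟩ := exists_base_ultrafilter U
  obtain ⟨F, hF, hFb⟩ := exists_mk_eq_coin
    (r := fun f g : {f : ℕ → ℕ // BoundedToBounded f} => {n : ℕ | f.1 n ≤ g.1 n} ∈ U.1)
    fun f => Filter.univ_mem' fun n => le_refl (f.1 n)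
  have key : ∀ (A : S) (f : F) (k : ℕ), ∃ n ∈ A.1, k ≤ n ∧ k < f.1.1 n := by
    intro A f k
    have h1 : ∀ᶠ n in cofinite, k ≤ n ∧ k < f.1.1 n := by
      rw [Nat.cofinite_eq_atTop]
      exact (eventually_ge_atTop k).and
        ((boundedToBounded_iff_tendsto.1 f.1.2).eventually_gt_atTop k)
    have h2 : {n | k ≤ n ∧ k < f.1.1 n} ∈ U.1 := by
      have := OmegaStar.compl_mem (U := U) (mem_cofinite.1 h1)
      rwa [compl_compl] at this
    obtain ⟨n, hn⟩ := Ultrafilter.nonempty_of_mem (Filter.inter_mem (hSU A A.2) h2)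
    exact ⟨n, hn.1, hn.2⟩
  choose h hA hk hf using key
  have hd : dominatingNumber ≤ max #(S × F) ℵ₀ := by
    refine dominatingNumber_le (h := fun z => h z.1 z.2) fun g => ?_
    have hinv : ∀ n : ℕ, ∃ m, n ≤ m + (Finset.range (m + 1)).sup g := fun n => ⟨n, by omega⟩
    classical
    have hb : BoundedToBounded fun n => Nat.find (hinv n) := by
      rw [boundedToBounded_iff_tendsto, tendsto_atTop]
      intro k
      filter_upwards [eventually_gt_atTop (k + (Finset.range (k + 1)).sup g)] with n hn
      rw [Nat.le_find_iff]
      intro m hm h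
      have : (Finset.range (m + 1)).sup g ≤ (Finset.range (k + 1)).sup g :=
        Finset.sup_mono (Finset.range_mono (by omega))
      omega
    obtain ⟨f, hfF, hfg⟩ := hFb ⟨_, hb⟩
    obtain ⟨A, hAS, hAf⟩ := hSb _ hfg
    refine ⟨(⟨A, hAS⟩, ⟨f, hfF⟩), ?_⟩
    have hfin := finite_diff_of_omegaStar hAf
    obtain ⟨K, hK⟩ := hfin.bddAbove
    filter_upwards [eventually_gt_atTop K] with k hKk
    set n := h ⟨A, hAS⟩ ⟨f, hfF⟩ k with hn
    have hnA : n ∈ A := hA ⟨A, hAS⟩ ⟨f, hfF⟩ k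
    have hkn : k ≤ n := hk ⟨A, hAS⟩ ⟨f, hfF⟩ k
    have hkf : k < f.1 n := hf ⟨A, hAS⟩ ⟨f, hfF⟩ k
    have hle : f.1 n ≤ Nat.find (hinv n) := by
      by_contra hcon
      have := hK ⟨hnA, hcon⟩
      omega
    have := Nat.find_min (hinv n) (lt_of_lt_of_le hkf hle)
    have hg : g k ≤ (Finset.range (k + 1)).sup g := Finset.le_sup (by simp)
    omega
  have h1 : dominatingNumber ≤ max (max (max (character U) (qNumber U)) ℵ₀) ℵ₀ := by
    refine hd.trans (max_le_max ?_ le_rfl)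
    calc #(S × F) = #S * #F := by simp
      _ ≤ max (max #S #F) ℵ₀ := mul_le_max _ _
      _ ≤ _ := max_le_max (max_le_max hS hF.le) le_rfl
  rw [max_assoc, max_self] at h1
  rcases le_max_iff.1 h1 with h2 | h2
  · exact h2
  · exact absurd aleph0_lt_dominatingNumber h2.not_gt

/-! ### The character of a point of the corona -/

theorem character_toCorona_le (p : Sharp X) :
    character (toCorona p) ≤ max (character p) (lift.{u} dominatingNumber) := by
  obtain ⟨o⟩ : Nonempty X := (Ultrafilter.nonempty_of_mem (univ_mem : Set.univ ∈ p.1)).to_type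
  obtain ⟨S, hS, hSp, hSb⟩ := exists_base_ultrafilter p
  obtain ⟨F, hF, hF'⟩ := Order.exists_cof_eq (α := ℕ → ℕ)
  have hle : lift.{u} (character (toCorona p)) ≤ lift.{u} #(S × F) := by
    refine lift_character_corona_le p
      -- A point `x` is thickened by radius `n` only once it is farther than `f n` from `o`.
      (A := fun z : S × F => {y | ∃ x ∈ z.1.1, ∃ n : ℕ, z.2.1 n < dist x o ∧ dist x y ≤ n})
      (fun z => ⟨z.1.1, hSp _ z.1.2, ?_⟩) fun B hB => ?_
    · rw [separated_iff o]
      intro ε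
      obtain ⟨n, hn⟩ := exists_nat_ge ε
      refine ⟨z.2.1 n, fun x hx y hy hxy => ?_⟩
      by_contra! h
      exact hy ⟨x, hx, n, h, hxy.trans hn⟩
    · obtain ⟨P, hP, hPB⟩ := hB
      obtain ⟨A, hAS, hAP⟩ := hSb P hP
      obtain ⟨R, hR⟩ := (Metric.isBounded_iff_subset_closedBall o).1 (isBounded_diff_of_sharp hAP)
      rw [separated_iff o] at hPB
      choose r hr using hPB
      obtain ⟨f, hfF, hf⟩ := hF fun n => ⌈max (r n) R⌉₊
      refine ⟨(⟨A, hAS⟩, ⟨f, hfF⟩), ?_⟩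
      rintro y ⟨x, hx, n, hn, hxy⟩
      have h1 : max (r n) R < dist x o :=
        ((Nat.le_ceil _).trans (Nat.cast_le.2 (hf n))).trans_lt hn
      have hxP : x ∈ P := by
        by_contra hxP
        exact ((le_max_right _ _).trans_lt h1).not_ge (hR ⟨hx, hxP⟩)
      by_contra hy
      exact ((le_max_left _ _).trans_lt h1).not_ge (hr n x hxP y hy hxy)
  have hd : ℵ₀ ≤ lift.{u} dominatingNumber := by simpa using aleph0_lt_dominatingNumber.le
  rw [Cardinal.lift_le] at hle
  calc character (toCorona p) ≤ #(S × F) := hle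
    _ = #S * lift.{u} dominatingNumber := by
      rw [mk_prod, hF', dominatingNumber, lift_uzero]
    _ ≤ max (max #S (lift.{u} dominatingNumber)) ℵ₀ := mul_le_max _ _
    _ ≤ _ := max_le (max_le_max hS le_rfl) (hd.trans (le_max_right _ _))

/-! ### The lower bound by the character of `φ(p)` -/

theorem exists_residue_mem (U : OmegaStar) (m : ℕ) (hm : 0 < m) :
    ∃ r, {n : ℕ | n % m = r} ∈ U.1 := by
  obtain ⟨r, -, hr⟩ := Ultrafilter.eq_pure_of_finite_mem (f := U.1.map (· % m)) (Set.finite_lt_nat m)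
    (Ultrafilter.mem_map.2 (Filter.univ_mem' fun n => Nat.mod_lt n hm))
  refine ⟨r, ?_⟩
  have h : ({r} : Set ℕ) ∈ U.1.map (· % m) := by
    rw [hr]
    exact Filter.mem_pure.2 rfl
  exact Ultrafilter.mem_map.1 h

theorem lift_character_image_le {φ : X → ℕ} (hosc : BoundedlyOscillating φ)
    (hφ : BoundedToBounded φ) (p : Sharp X) :
    lift.{u} (character (image φ hφ p)) ≤ character (toCorona p) := by
  obtain ⟨D, hD⟩ := hosc
  obtain ⟨m, hm⟩ := exists_nat_gt (max D 0)
  have hm0 : 0 < m := Nat.cast_pos.1 ((le_max_right D 0).trans_lt hm)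
  obtain ⟨r, hr⟩ := exists_residue_mem (image φ hφ p) m hm0
  obtain ⟨S, hS, hSp, hSb⟩ := exists_base_corona p
  refine le_trans ?_ hS
  have := lift_character_ultrafilter_le (image φ hφ p) (ι := S)
    (A := fun A => φ '' A.1 ∩ {n | n % m = r}) (fun A => ?_) fun B hB => ?_
  · simpa using this
  · obtain ⟨P, hP, hPA⟩ := hSp A.1 A.2
    refine Filter.inter_mem (Ultrafilter.mem_map.2 ?_) hr
    exact Filter.mem_of_superset (mem_of_separated_compl hP hPA) (Set.subset_preimage_image φ A.1)
  -- Bounded oscillation: moving by `ε` outside a bounded set changes `φ` by at most `D`.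
  · have hsep : Separated (φ ⁻¹' (B ∩ {n | n % m = r}))
        {y | ∃ b ∈ B, b % m = r ∧ dist (φ y) b ≤ D}ᶜ := by
      intro ε
      obtain ⟨C, hC, hCD⟩ := hD ε
      refine hC.subset ?_
      rintro x ⟨⟨hxB, hxr⟩, y, hy, hxy⟩
      by_contra hxC
      have hε : 0 ≤ ε := dist_nonneg.trans hxy
      exact hy ⟨φ x, hxB, hxr, hCD x hxC y (by rwa [Metric.mem_closedBall, dist_comm])
        x (Metric.mem_closedBall_self hε)⟩
    obtain ⟨A, hAS, hA⟩ := hSb _ ⟨_, Ultrafilter.mem_map.1 (Filter.inter_mem hB hr), hsep⟩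
    refine ⟨⟨A, hAS⟩, fun q hq => OmegaStar.mem_of_diff_finite
      ((isBounded_nat_iff.1 ((hφ _).1 hA)).subset ?_) hq⟩
    rintro _ ⟨⟨⟨x, hx, rfl⟩, hxr⟩, hxB⟩
    refine ⟨x, ⟨hx, ?_⟩, rfl⟩
    rintro ⟨b, hb, hbr, hxb⟩
    have h1 : φ x ≡ b [MOD m] := hxr.trans hbr.symm
    have h2 : dist (φ x) b < m := (hxb.trans (le_max_left _ _)).trans_lt hm
    rw [Nat.dist_eq] at h2
    have h3 : φ x = b := by
      have h4 : |(φ x : ℤ) - b| < m := by exact_mod_cast h2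
      have h5 : (m : ℤ) ∣ (φ x : ℤ) - b := (Nat.modEq_iff_dvd.1 h1.symm)
      have := Int.eq_zero_of_abs_lt_dvd h5 h4
      omega
    exact hxB (h3 ▸ hb)

/-! ### Porous neighborhoods and the lower bound by `𝔮(φ(p))` -/

/-- A function tending to infinity has a Lipschitz minorant tending to infinity. -/
theorem exists_lipschitz_minorant {s : X → ℝ} (hs0 : ∀ x, 0 ≤ s x)
    (hs : ∀ M : ℝ, Bornology.IsBounded {x | s x ≤ M}) :
    ∃ b : X → ℝ, (∀ x, 0 ≤ b x) ∧ (∀ x, 7 * b x ≤ s x) ∧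
      (∀ x y, b x ≤ b y + dist x y / 8) ∧ ∀ M : ℝ, Bornology.IsBounded {x | b x ≤ M} := by
  have hbdd : ∀ x, BddBelow (Set.range fun y => s y / 7 + dist x y / 8) := fun x =>
    ⟨0, by
      rintro _ ⟨y, rfl⟩
      have := hs0 y
      have := dist_nonneg (x := x) (y := y)
      positivity⟩
  -- An infimal convolution. The slope `1/8` keeps `b` comparable at points within the net's mesh;
  -- the factor `7` is later spent as `5 + 2`, going to a net point and on to a hole.
  refine ⟨fun x => ⨅ y, (s y / 7 + dist x y / 8), fun x => Real.iInf_nonneg fun y => ?_,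
    fun x => ?_, fun x y => ?_, fun M => ?_⟩
  · have := hs0 y
    positivity
  · have := ciInf_le (hbdd x) x
    simp only [dist_self] at this
    linarith
  · have : Nonempty X := ⟨x⟩
    rw [← sub_le_iff_le_add]
    refine le_ciInf fun z => ?_
    have := ciInf_le (hbdd x) z
    linarith [dist_triangle x y z]
  · refine ((hs (7 * (M + 1))).cthickening (δ := 8 * (M + 1))).subset fun x hx => ?_
    have : Nonempty X := ⟨x⟩
    obtain ⟨y, hy⟩ := exists_lt_of_ciInf_lt (show (⨅ y, (s y / 7 + dist x y / 8)) < M + 1 from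
      lt_of_le_of_lt hx (lt_add_one M))
    have h1 := hs0 y
    have h2 := dist_nonneg (x := x) (y := y)
    refine Metric.mem_cthickening_of_dist_le x y _ _ ?_ (by linarith)
    change s y ≤ 7 * (M + 1)
    linarith

/-- A natural number valued function `t` growing so slowly that `C ∘ t` stays below `b`. -/
theorem exists_slow_function {b : X → ℝ} (hb0 : ∀ x, 0 ≤ b x)
    (hb : ∀ M : ℝ, Bornology.IsBounded {x | b x ≤ M}) {C : ℕ → ℝ} (hC : C 0 = 0) :
    ∃ t : X → ℕ, (∀ x, (t x : ℝ) ≤ b x) ∧ (∀ x, C (t x) ≤ b x) ∧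
      ∀ M : ℝ, Bornology.IsBounded {x | (t x : ℝ) ≤ M} := by
  classical
  refine ⟨fun x => Nat.findGreatest (fun k => C k ≤ b x) ⌊b x⌋₊, fun x => ?_, fun x => ?_,
    fun M => ?_⟩
  · exact (Nat.cast_le.2 (Nat.findGreatest_le _)).trans (Nat.floor_le (hb0 x))
  -- `C 0 = 0` makes the default value `0` admissible.
  · exact Nat.findGreatest_spec (P := fun k => C k ≤ b x) (Nat.zero_le _) (hC ▸ hb0 x)
  · obtain ⟨k, hk⟩ := exists_nat_gt M
    refine (hb (max k (C k))).subset fun x hx => ?_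
    by_contra hx'
    have h1 : max (k : ℝ) (C k) < b x := not_le.1 hx'
    have h2 : k ≤ Nat.findGreatest (fun k => C k ≤ b x) ⌊b x⌋₊ :=
      Nat.le_findGreatest (Nat.le_floor ((le_max_left _ _).trans h1.le))
        ((le_max_right _ _).trans h1.le)
    have h3 : (k : ℝ) ≤ (Nat.findGreatest (fun k => C k ≤ b x) ⌊b x⌋₊ : ℕ) := Nat.cast_le.2 h2
    have h4 : ((Nat.findGreatest (fun k => C k ≤ b x) ⌊b x⌋₊ : ℕ) : ℝ) ≤ M := hx
    linarith

/-- A maximal net of variable mesh. -/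
theorem exists_net {b : X → ℝ} (hb0 : ∀ x, 0 ≤ b x) :
    ∃ L : Set X, (∀ l ∈ L, ∀ l' ∈ L, l ≠ l' → 3 * max (b l) (b l') < dist l l') ∧
      ∀ x, ∃ l ∈ L, dist x l ≤ 3 * max (b x) (b l) := by
  obtain ⟨L, hL⟩ := zorn_subset
    {L : Set X | ∀ l ∈ L, ∀ l' ∈ L, l ≠ l' → 3 * max (b l) (b l') < dist l l'} (by
      intro c hc hchain
      refine ⟨⋃₀ c, ?_, fun s hs => Set.subset_sUnion_of_mem hs⟩
      rintro l ⟨s, hs, hl⟩ l' ⟨s', hs', hl'⟩ hne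
      rcases hchain.total hs hs' with h | h
      · exact hc hs' l (h hl) l' hl' hne
      · exact hc hs l hl l' (h hl') hne)
  refine ⟨L, hL.1, fun x => ?_⟩
  by_contra! hx
  have hxL : x ∉ L := fun h => by
    have h1 := hx x h
    simp only [dist_self, max_self] at h1
    linarith [hb0 x]
  refine hxL (hL.2 (y := insert x L) ?_ (Set.subset_insert _ _) (Set.mem_insert _ _))
  rintro l (rfl | hl) l' (rfl | hl') hne
  · exact absurd rfl hne
  · exact hx l' hl'
  · rw [dist_comm, max_comm]
    exact hx l hl
  · exact hL.1 l hl l' hl' hne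

/-- For each `k` one radius `C k` enlarges every `k`-ball, so every annulus between `k` and `C k` is
nonempty. -/
theorem exists_gap (h : ¬ HasAsymptoticallyIsolatedBalls X) :
    ∃ C : ℕ → ℝ, C 0 = 0 ∧ ∀ (k : ℕ) (x : X), ∃ y, (k : ℝ) ≤ dist y x ∧ dist y x ≤ C k := by
  have key : ∀ k : ℕ, ∃ c : ℝ, (k = 0 → c = 0) ∧
      ∀ x : X, ∃ y, (k : ℝ) ≤ dist y x ∧ dist y x ≤ c := by
    intro k
    rcases Nat.eq_zero_or_pos k with rfl | hk
    · exact ⟨0, fun _ => rfl, fun x => ⟨x, by simp⟩⟩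
    · unfold HasAsymptoticallyIsolatedBalls at h
      push Not at h
      obtain ⟨δ, hδ, hx⟩ := h k
      refine ⟨δ, fun h0 => absurd h0 hk.ne', fun x => ?_⟩
      have h1 : ¬ Metric.closedBall x δ ⊆ Metric.closedBall x k := fun h2 =>
        hx x (Set.Subset.antisymm (Metric.closedBall_subset_closedBall hδ) h2)
      obtain ⟨y, hy, hy'⟩ := Set.not_subset.1 h1
      exact ⟨y, (not_le.1 hy').le, hy⟩
  choose C hC hC' using key
  exact ⟨C, hC 0 rfl, hC'⟩

/-- Without asymptotically isolated balls, each ultrafilter has an asymptotic neighborhood whose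
complement is met by all balls of a prescribed slowly growing radius. -/
theorem exists_porous_neighborhood (h : ¬ HasAsymptoticallyIsolatedBalls X) (p : Sharp X)
    {s : X → ℝ} (hs0 : ∀ x, 0 ≤ s x) (hs : ∀ M : ℝ, Bornology.IsBounded {x | s x ≤ M}) :
    ∃ B : Set X, (∃ P ∈ p.1, Separated P Bᶜ) ∧ ∀ x, ∃ y ∉ B, dist x y ≤ s x := by
  obtain ⟨b, hb0, hbs, hblip, hb⟩ := exists_lipschitz_minorant hs0 hs
  obtain ⟨C, hC0, hC⟩ := exists_gap h
  obtain ⟨t, htb, htC, ht⟩ := exists_slow_function hb0 hb hC0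
  obtain ⟨L, hL, hLx⟩ := exists_net hb0
  have hclose : ∀ x, ∃ l ∈ L, dist x l ≤ 5 * b x ∧ b l ≤ 2 * b x := by
    intro x
    obtain ⟨l, hl, hxl⟩ := hLx x
    have h1 := hblip l x
    rw [dist_comm] at h1
    have h2 := hb0 x
    have h3 := dist_nonneg (x := x) (y := l)
    have h4 : dist x l ≤ 5 * b x := by
      rcases le_total (b x) (b l) with h5 | h5
      · rw [max_eq_right h5] at hxl
        linarith
      · rw [max_eq_left h5] at hxl
        linarith
    exact ⟨l, hl, h4, by linarith⟩
  -- If `p` lives near the net, `B` is a union of disjoint balls and the holes lie just outside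
  -- them; otherwise the net points themselves are the holes.
  by_cases hN : {x | ∃ l ∈ L, dist x l < t l / 2} ∈ p.1
  · refine ⟨{x | ∃ l ∈ L, dist x l < t l}, ⟨_, hN, fun ε => ?_⟩, fun x => ?_⟩
    · refine ((ht (2 * ε)).cthickening (δ := ε)).subset ?_
      rintro x ⟨⟨l, hl, hxl⟩, y, hy, hxy⟩
      have h1 : (t l : ℝ) ≤ dist y l := not_lt.1 fun h2 => hy ⟨l, hl, h2⟩
      have h3 := dist_triangle y x l
      rw [dist_comm y x] at h3
      refine Metric.mem_cthickening_of_dist_le x l _ _ ?_ (by linarith)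
      change (t l : ℝ) ≤ 2 * ε
      linarith
    · obtain ⟨l, hl, hxl, hbl⟩ := hclose x
      obtain ⟨y, hy, hy'⟩ := hC (t l) l
      have hyb : dist y l ≤ b l := hy'.trans (htC l)
      refine ⟨y, ?_, ?_⟩
      · rintro ⟨l', hl', hyl'⟩
        rcases eq_or_ne l l' with rfl | hne
        · linarith
        -- Lying in another ball would give `dist l l' < b l + b l'`, against the mesh `3 * max (b
        -- l) (b l')`.
        · have h1 := hL l hl l' hl' hne
          have h2 := dist_triangle l y l'
          rw [dist_comm l y] at h2
          linarith [le_max_left (b l) (b l'), le_max_right (b l) (b l'), htb l', hb0 l, hb0 l']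
      · have h2 := dist_triangle x l y
        rw [dist_comm l y] at h2
        linarith [hbs x]
  · refine ⟨Lᶜ, ⟨_, Ultrafilter.compl_mem_iff_notMem.2 hN, ?_⟩, fun x => ?_⟩
    · rw [compl_compl]
      intro ε
      refine ((ht (2 * ε)).cthickening (δ := ε)).subset ?_
      rintro x ⟨hx, l, hl, hxl⟩
      have h1 : (t l : ℝ) / 2 ≤ dist x l := not_lt.1 fun h2 => hx ⟨l, hl, h2⟩
      refine Metric.mem_cthickening_of_dist_le x l _ _ ?_ hxl
      change (t l : ℝ) ≤ 2 * ε
      linarith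
    · obtain ⟨l, hl, hxl, -⟩ := hclose x
      exact ⟨l, fun h => h hl, hxl.trans (by linarith [hbs x, hb0 x])⟩

theorem lift_qNumber_image_le (h : ¬ HasAsymptoticallyIsolatedBalls X) {φ : X → ℕ}
    (hφ : BoundedToBounded φ) (p : Sharp X) :
    lift.{u} (qNumber (image φ hφ p)) ≤ character (toCorona p) := by
  classical
  obtain ⟨o⟩ : Nonempty X := (Ultrafilter.nonempty_of_mem (univ_mem : Set.univ ∈ p.1)).to_type
  obtain ⟨S, hS, hSp, hSb⟩ := exists_base_corona p
  refine le_trans ?_ hS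
  choose P hP hPA using fun A : S => hSp A.1 A.2
  -- An integer lower bound for the distance from `P A` to the complement of `A` along the fiber
  -- over `n`; the cap `n` keeps it finite.
  let f : S → ℕ → ℕ := fun A n =>
    Nat.findGreatest (fun k => ∀ x ∈ P A, φ x = n → ∀ y ∉ A.1, (k : ℝ) < dist x y) n
  have hf : ∀ A, BoundedToBounded (f A) := by
    intro A
    rw [boundedToBounded_iff_tendsto, tendsto_atTop]
    intro k
    obtain ⟨K, hK⟩ := (isBounded_nat_iff.1 ((hφ _).1 (hPA A k))).bddAbove
    filter_upwards [eventually_ge_atTop k, eventually_gt_atTop K] with n hkn hKn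
    refine Nat.le_findGreatest hkn fun x hx hxn y hy => ?_
    by_contra! hxy
    have := hK ⟨x, ⟨hx, y, hy, hxy⟩, rfl⟩
    omega
  have := lift_coin_le (r := fun f g : {f : ℕ → ℕ // BoundedToBounded f} =>
    {n : ℕ | f.1 n ≤ g.1 n} ∈ (image φ hφ p).1) (f := fun A : S => ⟨f A, hf A⟩) fun g => ?_
  · simpa [qNumber] using this
  · obtain ⟨B, hB, hBs⟩ := exists_porous_neighborhood h p
      -- The term `dist x o / 2` keeps the hole near a distant `x` out of the bounded set `A \ B`,
      -- so it is also a hole of `A`.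
      (s := fun x => min (g.1 (φ x) : ℝ) (dist x o / 2)) (fun x => by positivity) fun M => by
        have h1 : Bornology.IsBounded {x | φ x ∈ {n | g.1 n ≤ ⌊M⌋₊}} :=
          (hφ _).2 ((isBounded_preimage_Iic g.2 ⌊M⌋₊).subset (Set.image_preimage_subset φ _))
        refine (h1.union (Metric.isBounded_closedBall (x := o) (r := 2 * M))).subset fun x hx => ?_
        rcases min_le_iff.1 (show min (g.1 (φ x) : ℝ) (dist x o / 2) ≤ M from hx) with hx | hx
        · exact Or.inl (Nat.le_floor hx)
        · refine Or.inr ?_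
          rw [Metric.mem_closedBall]
          linarith
    obtain ⟨A, hAS, hAB⟩ := hSb B hB
    obtain ⟨R, hR⟩ := (Metric.isBounded_iff_subset_closedBall o).1 hAB
    refine ⟨⟨A, hAS⟩, Ultrafilter.mem_map.2 (Filter.mem_of_superset (Filter.inter_mem
      (hP ⟨A, hAS⟩) (p.2 _ (Metric.isBounded_closedBall (x := o) (r := 2 * R)))) fun x hx => ?_)⟩
    change f ⟨A, hAS⟩ (φ x) ≤ g.1 (φ x)
    by_contra! hlt
    obtain ⟨y, hyB, hxy⟩ := hBs x
    have hxR : 2 * R < dist x o := not_le.1 hx.2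
    have hyA : y ∉ A := by
      intro hyA
      have h1 : dist y o ≤ R := hR ⟨hyA, hyB⟩
      have h2 := hxy.trans (min_le_right _ _)
      linarith [dist_triangle x y o]
    -- Exceeding `g`, the value is not the default `0`, so it is a genuine lower bound for
    -- distances.
    have h3 := Nat.findGreatest_of_ne_zero (P := fun k : ℕ => ∀ x' ∈ P ⟨A, hAS⟩, φ x' = φ x →
      ∀ y ∉ A, (k : ℝ) < dist x' y) (n := φ x) rfl (Nat.ne_of_gt (Nat.zero_lt_of_lt hlt))
      x hx.1 rfl y hyA
    have h4 : (g.1 (φ x) : ℝ) < (f ⟨A, hAS⟩ (φ x) : ℕ) := Nat.cast_lt.2 hlt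
    exact absurd (hxy.trans (min_le_left _ _)) (not_le.2 (h4.trans h3))

end Higson

theorem theorem4 {X : Type u} [MetricSpace X]
    (hX : ¬ Bornology.IsBounded (Set.univ : Set X))
    (φ : X → ℕ) (hosc : Higson.BoundedlyOscillating φ) (hφ : Higson.BoundedToBounded φ)
    (p : Higson.Sharp X) :
    Higson.character (Higson.toCorona p) ≤
        max (Higson.character p) (Cardinal.lift.{u} Higson.dominatingNumber) ∧
      (Cardinal.lift.{u} (Higson.character (Higson.image φ hφ p)) ≤
          Higson.character (Higson.toCorona p) ∧
        Higson.ultrafilterNumber ≤ Higson.character (Higson.image φ hφ p)) ∧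
      (¬ Higson.HasAsymptoticallyIsolatedBalls X →
        Cardinal.lift.{u} (max (Higson.character (Higson.image φ hφ p))
            (Higson.qNumber (Higson.image φ hφ p))) ≤
          Higson.character (Higson.toCorona p) ∧
        max Higson.ultrafilterNumber Higson.dominatingNumber ≤
          max (Higson.character (Higson.image φ hφ p))
            (Higson.qNumber (Higson.image φ hφ p))) := by
  exact ⟨Higson.character_toCorona_le p,
    ⟨Higson.lift_character_image_le hosc hφ p,
      ciInf_le' (fun U : Higson.OmegaStar => Higson.character U) (Higson.image φ hφ p)⟩,
    fun h => ⟨by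
      rw [Cardinal.lift_max]
      exact max_le (Higson.lift_character_image_le hosc hφ p)
        (Higson.lift_qNumber_image_le h hφ p),
      max_le ((ciInf_le' (fun U : Higson.OmegaStar => Higson.character U)
        (Higson.image φ hφ p)).trans (le_max_left _ _)) (Higson.dominatingNumber_le_max _)⟩⟩
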